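/- Let $\mathfrak g$ be a nonsemisimple Lie algebra over $\mathbb C$ (of arbitrary dimension), $\mathfrak p$ an ideal of $\mathfrak g$ with $[\mathfrak p,\mathfrak p]\neq\mathfrak p$, and $\phi:\mathfrak p\to\mathbb C$ a Lie algebra homomorphism. For a $\mathfrak g$-module $V$ put $V_\phi=\{v\in V\mid pv=\phi(p)v\ \ \forall p\in\mathfrak p\}$; its elements are the quasi-Whittaker vectors of type $\phi$, and $V$ is called a quasi-Whittaker module of type $\phi$ if it is generated as a $\mathfrak g$-module by a quasi-Whittaker vector of type $\phi$. An irreducible quasi-Whittaker module $V$ of type $\phi$ is called bland if $\dim V_\phi=1$. Let $$\mathfrak g^\phi=\{g\in\mathfrak g\mid \phi([g,p])=0\ \ \forall p\in\mathfrak p\},$$ a subalgebra of $\mathfrak g$ containing $\mathfrak p$. Let $W(\phi)=\mathrm{Ind}_{\mathfrak p}^{\mathfrak g}\,\mathbb C w_\phi=U(\mathfrak g)\otimes_{U(\mathfrak p)}\mathbb C w_\phi$, where $p\,w_\phi=\phi(p)w_\phi$ for $p\in\mathfrak p$, and for a Lie algebra homomorphism $\phi':\mathfrak g^\phi\to\mathbb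 C$ extending $\phi$ let $V(\phi')=\mathrm{Ind}_{\mathfrak g^\phi}^{\mathfrak g}\,\mathbb C v_{\phi'}=U(\mathfrak g)\otimes_{U(\mathfrak g^\phi)}\mathbb C v_{\phi'}$, where $y\,v_{\phi'}=\phi'(y)v_{\phi'}$ for $y\in\mathfrak g^\phi$. **Theorem 3.10.** If $\dim \mathfrak g^\phi/\mathfrak p\le 1$, then every irreducible quasi-Whittaker $\mathfrak g$-module $V$ of type $\phi$ is bland. Moreover, if $\dim\mathfrak g^\phi/\mathfrak p=0$, then $V\cong W(\phi)$; if $\dim\mathfrak g^\phi/\mathfrak p=1$, then $V\cong V(\phi')$ for some Lie algebra homomorphism $\phi':\mathfrak g^\phi\to\mathbb C$ extending $\phi$. -/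

import Mathlib

open scoped TensorProduct

noncomputable section

namespace QuasiWhittaker

open LieAlgebra

section InducedModules

variable {H : Type*} [LieRing H] [LieAlgebra ℂ H]
variable {G : Type*} [LieRing G] [LieAlgebra ℂ G]

section

attribute [local instance] LieRing.ofAssociativeRing

/-- The algebra homomorphism `U(H) → U(G)` induced by a Lie algebra homomorphism `H → G`. -/
def envelopingMap (f : H →ₗ⁅ℂ⁆ G) :
    UniversalEnvelopingAlgebra ℂ H →ₐ[ℂ] UniversalEnvelopingAlgebra ℂ G :=
  UniversalEnvelopingAlgebra.lift ℂ ((UniversalEnvelopingAlgebra.ι ℂ : G →ₗ⁅ℂ⁆ _).comp f)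

end

variable (M : Type*) [AddCommGroup M] [Module ℂ M] [LieRingModule H M] [LieModule ℂ H M]

/-- The action of `U(H)` on an `H`-module `M`. -/
def envelopingAction : UniversalEnvelopingAlgebra ℂ H →ₐ[ℂ] Module.End ℂ M :=
  UniversalEnvelopingAlgebra.lift ℂ (LieModule.toEnd ℂ H M)

/-- The `U(G)`-submodule of `U(G) ⊗_ℂ M` spanned by the elements `u a ⊗ m - u ⊗ a m`,
with `u ∈ U(G)`, `a ∈ U(H)`, `m ∈ M`. -/
def balancedRelations (f : H →ₗ⁅ℂ⁆ G) :
    Submodule (UniversalEnvelopingAlgebra ℂ G) (UniversalEnvelopingAlgebra ℂ G ⊗[ℂ] M) :=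
  Submodule.span _ {t | ∃ (u : UniversalEnvelopingAlgebra ℂ G)
    (a : UniversalEnvelopingAlgebra ℂ H) (m : M),
    t = (u * envelopingMap f a) ⊗ₜ[ℂ] m - u ⊗ₜ[ℂ] (envelopingAction M a m)}

/-- The induced module `U(G) ⊗_{U(H)} M` of an `H`-module `M` along a Lie algebra homomorphism
`H → G`; for the inclusion of a Lie subalgebra this is `Ind_H^G M`. -/
def Induced (f : H →ₗ⁅ℂ⁆ G) : Type _ :=
  (UniversalEnvelopingAlgebra ℂ G ⊗[ℂ] M) ⧸ balancedRelations M f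

namespace Induced

variable (f : H →ₗ⁅ℂ⁆ G)

instance : AddCommGroup (Induced M f) :=
  inferInstanceAs (AddCommGroup ((UniversalEnvelopingAlgebra ℂ G ⊗[ℂ] M) ⧸ balancedRelations M f))

instance : Module (UniversalEnvelopingAlgebra ℂ G) (Induced M f) :=
  inferInstanceAs (Module (UniversalEnvelopingAlgebra ℂ G)
    ((UniversalEnvelopingAlgebra ℂ G ⊗[ℂ] M) ⧸ balancedRelations M f))

instance : Module ℂ (Induced M f) :=
  inferInstanceAs (Module ℂ ((UniversalEnvelopingAlgebra ℂ G ⊗[ℂ] M) ⧸ balancedRelations M f))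

instance : IsScalarTower ℂ (UniversalEnvelopingAlgebra ℂ G) (Induced M f) :=
  inferInstanceAs (IsScalarTower ℂ (UniversalEnvelopingAlgebra ℂ G)
    ((UniversalEnvelopingAlgebra ℂ G ⊗[ℂ] M) ⧸ balancedRelations M f))

/-- `G` acts on the induced module through `G → U(G)`. -/
instance : LieRingModule G (Induced M f) where
  bracket x w := UniversalEnvelopingAlgebra.ι ℂ x • w
  add_lie x y w := by
    change UniversalEnvelopingAlgebra.ι ℂ (x + y) • w = _ • w + _ • w
    rw [map_add, add_smul]
  lie_add x w w' := smul_add _ _ _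
  leibniz_lie x y w := by
    change UniversalEnvelopingAlgebra.ι ℂ x • UniversalEnvelopingAlgebra.ι ℂ y • w =
      UniversalEnvelopingAlgebra.ι ℂ ⁅x, y⁆ • w +
        UniversalEnvelopingAlgebra.ι ℂ y • UniversalEnvelopingAlgebra.ι ℂ x • w
    let _ : LieRing (UniversalEnvelopingAlgebra ℂ G) := LieRing.ofAssociativeRing
    rw [LieHom.map_lie, LieRing.of_associative_ring_bracket, sub_smul, mul_smul, mul_smul,
      sub_add_cancel]

instance : LieModule ℂ G (Induced M f) where
  smul_lie c x w := by
    change UniversalEnvelopingAlgebra.ι ℂ (c • x) • w = c • UniversalEnvelopingAlgebra.ι ℂ x • w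
    rw [map_smul, smul_assoc]
  lie_smul c x w := by
    change UniversalEnvelopingAlgebra.ι ℂ x • c • w = c • UniversalEnvelopingAlgebra.ι ℂ x • w
    rw [← algebraMap_smul (UniversalEnvelopingAlgebra ℂ G) c w, ← mul_smul,
      ← Algebra.commutes, ← Algebra.smul_def, smul_assoc]

end Induced

/-- The one-dimensional `H`-module `ℂ` on which `x ∈ H` acts as multiplication by `χ x`. -/
def CharModule (_χ : LieCharacter ℂ H) : Type := ℂ

namespace CharModule

variable (χ : LieCharacter ℂ H)

instance : AddCommGroup (CharModule χ) := inferInstanceAs (AddCommGroup ℂ)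

instance : Module ℂ (CharModule χ) := inferInstanceAs (Module ℂ ℂ)

instance : LieRingModule H (CharModule χ) where
  bracket x z := χ x • z
  add_lie x y z := by
    rw [map_add, add_smul]
  lie_add x z z' := smul_add _ _ _
  leibniz_lie x y z := by
    change χ x • χ y • z = χ ⁅x, y⁆ • z + χ y • χ x • z
    rw [lieCharacter_apply_lie, zero_smul, zero_add, smul_comm]

instance : LieModule ℂ H (CharModule χ) where
  smul_lie c x z := by
    change χ (c • x) • z = c • χ x • z
    rw [map_smul, smul_assoc]
  lie_smul c x z := smul_comm (χ x) c z

end CharModule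

end InducedModules

section Definitions

variable {G : Type*} [LieRing G] [LieAlgebra ℂ G] {P : LieIdeal ℂ G}

/-- A vector `v` with `p v = φ(p) v` for all `p ∈ P`. -/
def IsQuasiWhittakerVector (φ : LieCharacter ℂ P) {V : Type*} [AddCommGroup V] [Module ℂ V]
    [LieRingModule G V] (v : V) : Prop :=
  ∀ p : P, ⁅(p : G), v⁆ = φ p • v

/-- `V` is generated, as a `G`-module, by a quasi-Whittaker vector of type `φ`. -/
def IsQuasiWhittakerModule (φ : LieCharacter ℂ P) (V : Type*) [AddCommGroup V] [Module ℂ V]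
    [LieRingModule G V] : Prop :=
  ∃ v : V, IsQuasiWhittakerVector φ v ∧ LieSubmodule.lieSpan ℂ G {v} = ⊤

/-- The subspace `V_φ` of all quasi-Whittaker vectors of type `φ`. -/
def quasiWhittakerSpace (φ : LieCharacter ℂ P) (V : Type*) [AddCommGroup V] [Module ℂ V]
    [LieRingModule G V] [LieModule ℂ G V] : Submodule ℂ V where
  carrier := {v | IsQuasiWhittakerVector φ v}
  zero_mem' p := by rw [lie_zero, smul_zero]
  add_mem' {v w} hv hw p := by rw [lie_add, hv p, hw p, smul_add]
  smul_mem' c v hv p := by rw [lie_smul, hv p, smul_comm]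

/-- `dim V_φ = 1`: up to a scalar there is exactly one nonzero quasi-Whittaker vector of
type `φ`. (Used for irreducible quasi-Whittaker modules of type `φ`.) -/
def IsBland (φ : LieCharacter ℂ P) (V : Type*) [AddCommGroup V] [Module ℂ V]
    [LieRingModule G V] [LieModule ℂ G V] : Prop :=
  Module.rank ℂ (quasiWhittakerSpace φ V) = 1

/-- The Whittaker annihilator `G^φ = {g ∈ G | φ([g, p]) = 0 for all p ∈ P}`. -/
def whittakerAnnihilator (φ : LieCharacter ℂ P) : LieSubalgebra ℂ G where
  carrier := {g | ∀ p : P, φ ⁅g, p⁆ = 0}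
  zero_mem' p := by rw [zero_lie, map_zero]
  add_mem' {x y} hx hy p := by rw [add_lie, map_add, hx p, hy p, add_zero]
  smul_mem' c x hx p := by rw [smul_lie, map_smul, hx p, smul_zero]
  lie_mem' {x y} hx hy p := by rw [lie_lie, map_sub, hx, hy, sub_zero]

theorem mem_whittakerAnnihilator (φ : LieCharacter ℂ P) (p : P) :
    (p : G) ∈ whittakerAnnihilator φ := fun q => lieCharacter_apply_lie φ p q

/-- `φ'` is a Lie algebra homomorphism `G^φ → ℂ` extending `φ`. -/
def IsExtension (φ : LieCharacter ℂ P) (φ' : LieCharacter ℂ (whittakerAnnihilator φ)) : Prop :=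
  ∀ p : P, φ' ⟨(p : G), mem_whittakerAnnihilator φ p⟩ = φ p

/-- `P` as an ideal of `G^φ`. -/
def idealInAnnihilator (φ : LieCharacter ℂ P) : LieIdeal ℂ (whittakerAnnihilator φ) :=
  P.comap (whittakerAnnihilator φ).incl

/-- The universal quasi-Whittaker module `W(φ) = Ind_P^G ℂ_φ`. -/
abbrev universalModule (φ : LieCharacter ℂ P) : Type _ :=
  Induced (CharModule φ) P.incl

/-- The module `V(φ') = Ind_{G^φ}^G ℂ_φ'`. -/
abbrev extensionModule (φ : LieCharacter ℂ P) (φ' : LieCharacter ℂ (whittakerAnnihilator φ)) :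
    Type _ :=
  Induced (CharModule φ') (whittakerAnnihilator φ).incl

end Definitions

end QuasiWhittaker

end

open scoped TensorProduct

noncomputable section

namespace QuasiWhittaker

open LieAlgebra

/-! ### Filtrations generated by quasi-Whittaker vectors -/

section Filtration

variable {G : Type*} [LieRing G] [LieAlgebra ℂ G] {P : LieIdeal ℂ G}
variable {V : Type*} [AddCommGroup V] [Module ℂ V] [LieRingModule G V]

/-- The filtration of `V` by the subspaces spanned by the products of fewer than `n` elements of
`G` applied to `N`. -/
def productFiltration (G : Type*) [LieRing G] [LieAlgebra ℂ G] {V : Type*} [AddCommGroup V]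
    [Module ℂ V] [LieRingModule G V] (N : Submodule ℂ V) : ℕ → Submodule ℂ V
  | 0 => ⊥
  | n + 1 => N ⊔ Submodule.span ℂ {w | ∃ (x : G), ∃ k ∈ productFiltration G N n, ⁅x, k⁆ = w}

theorem productFiltration_succ_induction {N : Submodule ℂ V} {n : ℕ} {p : V → Prop}
    (base : ∀ u ∈ N, p u) (lie : ∀ (x : G), ∀ k ∈ productFiltration G N n, p ⁅x, k⁆)
    (add : ∀ a b, p a → p b → p (a + b)) (smul : ∀ (c : ℂ) a, p a → p (c • a))
    {k : V} (hk : k ∈ productFiltration G N (n + 1)) : p k := by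
  obtain ⟨u, hu, w, hw, rfl⟩ := Submodule.mem_sup.1 hk
  refine add _ _ (base u hu) ?_
  clear hk
  induction hw using Submodule.span_induction with
  | mem w h => obtain ⟨x, k, hk, rfl⟩ := h; exact lie x k hk
  | zero => exact base 0 N.zero_mem
  | add a b _ _ ha hb => exact add a b ha hb
  | smul c a _ ha => exact smul c a ha

theorem lie_mem_productFiltration {N : Submodule ℂ V} {n : ℕ} (x : G) {k : V}
    (hk : k ∈ productFiltration G N n) : ⁅x, k⁆ ∈ productFiltration G N (n + 1) :=
  Submodule.mem_sup_right (Submodule.subset_span ⟨x, k, hk, rfl⟩)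

theorem le_productFiltration_succ (N : Submodule ℂ V) (n : ℕ) :
    N ≤ productFiltration G N (n + 1) := le_sup_left

theorem productFiltration_le_succ (N : Submodule ℂ V) (n : ℕ) :
    productFiltration G N n ≤ productFiltration G N (n + 1) := by
  induction n with
  | zero => exact bot_le
  | succ n ih =>
    refine sup_le_sup_left (Submodule.span_mono ?_) N
    rintro _ ⟨x, k, hk, rfl⟩
    exact ⟨x, k, ih hk, rfl⟩

theorem exists_mem_productFiltration {N : Submodule ℂ V}
    (hN : LieSubmodule.lieSpan ℂ G (N : Set V) = ⊤) (v : V) :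
    ∃ n, v ∈ productFiltration G N n := by
  have hmono : Monotone (productFiltration G N) :=
    monotone_nat_of_le_succ (productFiltration_le_succ N)
  have hv : v ∈ LieSubmodule.lieSpan ℂ G (N : Set V) := hN ▸ LieSubmodule.mem_top v
  induction hv using LieSubmodule.lieSpan_induction with
  | mem u hu => exact ⟨1, le_productFiltration_succ N 0 hu⟩
  | zero => exact ⟨0, zero_mem _⟩
  | add a b _ _ ha hb =>
    obtain ⟨m, hm⟩ := ha
    obtain ⟨n, hn⟩ := hb
    exact ⟨max m n, add_mem (hmono (le_max_left _ _) hm) (hmono (le_max_right _ _) hn)⟩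
  | smul c a _ ha =>
    obtain ⟨m, hm⟩ := ha
    exact ⟨m, Submodule.smul_mem _ c hm⟩
  | lie x a _ ha =>
    obtain ⟨m, hm⟩ := ha
    exact ⟨m + 1, lie_mem_productFiltration x hm⟩

variable [LieModule ℂ G V]

/-- The operator `v ↦ p v - φ(p) v`. -/
def whittakerOperator (φ : LieCharacter ℂ P) (V : Type*) [AddCommGroup V] [Module ℂ V]
    [LieRingModule G V] [LieModule ℂ G V] (p : P) : V →ₗ[ℂ] V :=
  LieModule.toEnd ℂ G V (p : G) - φ p • LinearMap.id

theorem whittakerOperator_apply (φ : LieCharacter ℂ P) (p : P) (v : V) :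
    whittakerOperator φ V p v = ⁅(p : G), v⁆ - φ p • v := rfl

theorem whittakerOperator_eq_zero {φ : LieCharacter ℂ P} {v : V}
    (hv : v ∈ quasiWhittakerSpace φ V) (p : P) : whittakerOperator φ V p v = 0 :=
  sub_eq_zero.2 (hv p)

theorem whittakerOperator_lie (φ : LieCharacter ℂ P) (p : P) (x : G) (v : V) :
    whittakerOperator φ V p ⁅x, v⁆ =
      ⁅x, whittakerOperator φ V p v⁆ - ⁅((⁅x, p⁆ : P) : G), v⁆ := by
  simp only [whittakerOperator_apply, LieSubmodule.coe_bracket, lie_sub, lie_smul, lie_lie]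
  abel

/-- `N` is a subspace of `V_φ` stable under `G^φ`. -/
structure IsStableWhittaker (φ : LieCharacter ℂ P) (N : Submodule ℂ V) : Prop where
  le : N ≤ quasiWhittakerSpace φ V
  lie_mem : ∀ x ∈ whittakerAnnihilator φ, ∀ u ∈ N, ⁅x, u⁆ ∈ N

variable {φ : LieCharacter ℂ P} {N : Submodule ℂ V}

theorem IsStableWhittaker.lie_mem_productFiltration (hN : IsStableWhittaker φ N) {n : ℕ} {k : V}
    (hk : k ∈ productFiltration G N n) :
    ∀ h ∈ whittakerAnnihilator φ, ⁅h, k⁆ ∈ productFiltration G N n := by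
  induction n generalizing k with
  | zero =>
    intro h _
    rw [show k = 0 from hk, lie_zero]
    exact zero_mem _
  | succ n ih =>
    refine productFiltration_succ_induction (p := fun k => ∀ h ∈ whittakerAnnihilator φ,
      ⁅h, k⁆ ∈ productFiltration G N (n + 1)) ?_ ?_ ?_ ?_ hk
    · exact fun u hu h hh => le_productFiltration_succ N n (hN.lie_mem h hh u hu)
    · intro x k hk h hh
      rw [leibniz_lie]
      exact add_mem (QuasiWhittaker.lie_mem_productFiltration _ hk)
        (QuasiWhittaker.lie_mem_productFiltration _ (ih hk h hh))
    · intro a b ha hb h hh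
      rw [lie_add]
      exact add_mem (ha h hh) (hb h hh)
    · intro c a ha h hh
      rw [lie_smul]
      exact Submodule.smul_mem _ c (ha h hh)

/-- Moving `p - φ(p)` past `x` costs only the action of `[x, p] ∈ P ⊆ G^φ`, which preserves each
layer. -/
theorem IsStableWhittaker.whittakerOperator_mem (hN : IsStableWhittaker φ N) {n : ℕ} {k : V}
    (hk : k ∈ productFiltration G N (n + 1)) (p : P) :
    whittakerOperator φ V p k ∈ productFiltration G N n := by
  induction n generalizing k p with
  | zero =>
    refine productFiltration_succ_induction (p := fun k => ∀ p : P,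
      whittakerOperator φ V p k ∈ productFiltration G N 0) ?_ ?_ ?_ ?_ hk p
    · exact fun u hu p => whittakerOperator_eq_zero (hN.le hu) p
    · intro x k hk p
      rw [show k = 0 from hk, lie_zero, map_zero]
      exact zero_mem _
    · intro a b ha hb p
      rw [map_add]
      exact add_mem (ha p) (hb p)
    · intro c a ha p
      rw [map_smul]
      exact Submodule.smul_mem _ c (ha p)
  | succ n ih =>
    refine productFiltration_succ_induction (p := fun k => ∀ p : P,
      whittakerOperator φ V p k ∈ productFiltration G N (n + 1)) ?_ ?_ ?_ ?_ hk p
    · intro u hu p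
      rw [whittakerOperator_eq_zero (hN.le hu) p]
      exact zero_mem _
    · intro x k hk p
      rw [whittakerOperator_lie]
      exact sub_mem (QuasiWhittaker.lie_mem_productFiltration _ (ih hk p))
        (hN.lie_mem_productFiltration hk _ (mem_whittakerAnnihilator φ _))
    · intro a b ha hb p
      rw [map_add]
      exact add_mem (ha p) (hb p)
    · intro c a ha p
      rw [map_smul]
      exact Submodule.smul_mem _ c (ha p)

/-! ### Dual families and Euler operators -/

/-- The endomorphism `g ↦ ∑ φ([p, g]) x` attached to a list of pairs `(p, x)`. -/
def pairingSum (φ : LieCharacter ℂ P) (L : List (P × G)) (g : G) : G :=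
  (L.map fun a => (-φ ⁅g, a.1⁆) • a.2).sum

/-- Modulo `G^φ`, finitely many elements of `G` have a dual family in `P` for the pairing
`φ([p, g])`. -/
theorem exists_pairingSum (φ : LieCharacter ℂ P) (S : Finset G) :
    ∃ L : List (P × G), ∀ g ∈ S, g - pairingSum φ L g ∈ whittakerAnnihilator φ := by
  classical
  induction S using Finset.induction_on with
  | empty => exact ⟨[], by simp⟩
  | insert g S _ ih =>
    obtain ⟨L, hL⟩ := ih
    set g' := g - pairingSum φ L g with hg'
    by_cases hmem : g' ∈ whittakerAnnihilator φ
    · refine ⟨L, fun y hy => ?_⟩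
      rcases Finset.mem_insert.1 hy with rfl | hy
      exacts [hmem, hL y hy]
    · obtain ⟨p, hp⟩ : ∃ p : P, φ ⁅g', p⁆ ≠ 0 := by
        by_contra! h
        exact hmem h
      -- The normalization makes `q` dual to the residue `g'`: `φ([q, g']) = 1`.
      set c : ℂ := -(φ ⁅g', p⁆)⁻¹ with hc
      set q : P := c • p with hq
      have hφq : φ ⁅g', q⁆ = -1 := by
        rw [hq, lie_smul, map_smul, hc, smul_eq_mul, neg_mul, inv_mul_cancel₀ hp]
      -- A Gram–Schmidt step: the new residue map is the old one followed by `z ↦ z + φ([z, q]) g'`.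
      -- This sends `g'` to zero and fixes `G^φ`, hence fixes the residues already in `G^φ`.
      set L' : List (P × G) := (q, g') :: L.map fun a => (a.1, a.2 + φ ⁅a.2, q⁆ • g') with hL'
      have key : ∀ y, y - pairingSum φ L' y =
          (y - pairingSum φ L y) + φ ⁅y - pairingSum φ L y, q⁆ • g' := by
        intro y
        have h1 : ∀ M : List (P × G),
            pairingSum φ (M.map fun a => (a.1, a.2 + φ ⁅a.2, q⁆ • g')) y =
              pairingSum φ M y + φ ⁅pairingSum φ M y, q⁆ • g' := by
          intro M
          induction M with
          | nil => simp [pairingSum]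
          | cons a M ihM =>
            simp only [pairingSum, List.map_cons, List.sum_cons] at ihM ⊢
            rw [ihM, add_lie, smul_lie, map_add, map_smul, smul_eq_mul]
            module
        have h2 : pairingSum φ L' y = (-φ ⁅y, q⁆) • g' +
            pairingSum φ (L.map fun a => (a.1, a.2 + φ ⁅a.2, q⁆ • g')) y := by
          simp [pairingSum, hL']
        rw [h2, h1, sub_lie, map_sub]
        module
      refine ⟨L', fun y hy => ?_⟩
      rw [key]
      rcases Finset.mem_insert.1 hy with rfl | hy
      · rw [← hg', hφq, neg_one_smul, add_neg_cancel]
        exact zero_mem _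
      · rw [hL y hy q, zero_smul, add_zero]
        exact hL y hy

/-- The operator `∑ x (p - φ(p))` attached to a list of pairs `(p, x)`. -/
def eulerOperator (φ : LieCharacter ℂ P) (V : Type*) [AddCommGroup V] [Module ℂ V]
    [LieRingModule G V] [LieModule ℂ G V] (L : List (P × G)) : V →ₗ[ℂ] V :=
  (L.map fun a => LieModule.toEnd ℂ G V a.2 ∘ₗ whittakerOperator φ V a.1).sum

theorem eulerOperator_cons (a : P × G) (L : List (P × G)) (v : V) :
    eulerOperator φ V (a :: L) v =
      ⁅a.2, whittakerOperator φ V a.1 v⁆ + eulerOperator φ V L v := by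
  simp [eulerOperator]

theorem eulerOperator_eq_zero {v : V} (hv : ∀ p, whittakerOperator φ V p v = 0)
    (L : List (P × G)) : eulerOperator φ V L v = 0 := by
  induction L with
  | nil => simp [eulerOperator]
  | cons a L ih => rw [eulerOperator_cons, hv, lie_zero, ih, add_zero]

/-- An approximate Leibniz rule. Every error term applies some `p - φ(p)`, which lowers the layer,
and then one element of `G`, which restores it. -/
theorem IsStableWhittaker.eulerOperator_lie_mem (hN : IsStableWhittaker φ N) (L : List (P × G))
    {n : ℕ} {k : V} (hk : k ∈ productFiltration G N (n + 1)) (x : G) :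
    eulerOperator φ V L ⁅x, k⁆ - (⁅pairingSum φ L x, k⁆ + ⁅x, eulerOperator φ V L k⁆) ∈
      productFiltration G N (n + 1) := by
  induction L with
  | nil => simp [eulerOperator, pairingSum]
  | cons a L ih =>
    have h1 : ⁅a.2, whittakerOperator φ V (⁅x, a.1⁆ : P) k⁆ ∈ productFiltration G N (n + 1) :=
      QuasiWhittaker.lie_mem_productFiltration _ (hN.whittakerOperator_mem hk _)
    have h2 : ⁅⁅a.2, x⁆, whittakerOperator φ V a.1 k⁆ ∈ productFiltration G N (n + 1) :=
      QuasiWhittaker.lie_mem_productFiltration _ (hN.whittakerOperator_mem hk _)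
    convert add_mem ih (sub_mem h2 h1) using 1
    have h3 : pairingSum φ (a :: L) x = (-φ ⁅x, a.1⁆) • a.2 + pairingSum φ L x := by
      simp [pairingSum]
    rw [eulerOperator_cons, eulerOperator_cons, h3, whittakerOperator_lie, add_lie, smul_lie,
      lie_add, lie_sub, leibniz_lie a.2 x, whittakerOperator_apply φ ⁅x, a.1⁆, lie_sub, lie_smul,
      neg_smul]
    abel

/-- A suitable Euler operator acts on the `n`-th layer of the filtration as multiplication
by `n`. -/
theorem IsStableWhittaker.exists_eulerOperator (hN : IsStableWhittaker φ N) {n : ℕ} {k : V}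
    (hk : k ∈ productFiltration G N (n + 1)) :
    ∃ S : Finset G, ∀ L : List (P × G),
      (∀ g ∈ S, g - pairingSum φ L g ∈ whittakerAnnihilator φ) →
      eulerOperator φ V L k - (n : ℂ) • k ∈ productFiltration G N n := by
  classical
  induction n generalizing k with
  | zero =>
    refine ⟨∅, fun L _ => ?_⟩
    rw [eulerOperator_eq_zero fun p => hN.whittakerOperator_mem hk p]
    simp
  | succ n ih =>
    refine productFiltration_succ_induction (p := fun k => ∃ S : Finset G, ∀ L : List (P × G),
      (∀ g ∈ S, g - pairingSum φ L g ∈ whittakerAnnihilator φ) →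
      eulerOperator φ V L k - ((n + 1 : ℕ) : ℂ) • k ∈ productFiltration G N (n + 1)) ?_ ?_ ?_ ?_ hk
    · refine fun u hu => ⟨∅, fun L _ => ?_⟩
      rw [eulerOperator_eq_zero fun p => whittakerOperator_eq_zero (hN.le hu) p, zero_sub]
      exact neg_mem (Submodule.smul_mem _ _ (le_productFiltration_succ N n hu))
    · intro x k hk
      obtain ⟨S, hS⟩ := ih hk
      -- Since `x` agrees with `pairingSum φ L x` modulo `G^φ`, applying `x` raises the Euler
      -- eigenvalue by exactly one.
      refine ⟨insert x S, fun L hL => ?_⟩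
      have h1 := QuasiWhittaker.lie_mem_productFiltration x
        (hS L fun g hg => hL g (Finset.mem_insert_of_mem hg))
      have h2 := hN.lie_mem_productFiltration hk _ (hL x (Finset.mem_insert_self x S))
      convert add_mem (sub_mem (hN.eulerOperator_lie_mem L hk x) h2) h1 using 1
      rw [sub_lie, lie_sub, lie_smul]
      push_cast
      module
    · rintro a b ⟨S, hS⟩ ⟨T, hT⟩
      refine ⟨S ∪ T, fun L hL => ?_⟩
      convert add_mem (hS L fun g hg => hL g (Finset.mem_union_left T hg))
        (hT L fun g hg => hL g (Finset.mem_union_right S hg)) using 1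
      rw [map_add]
      module
    · rintro c a ⟨S, hS⟩
      refine ⟨S, fun L hL => ?_⟩
      convert Submodule.smul_mem _ c (hS L hL) using 1
      rw [map_smul]
      module

/-! ### Consequences: all of `V_φ`, and submodules meeting `N` -/

/-- A `G^φ`-stable space of quasi-Whittaker vectors which generates `V` is all of `V_φ`. -/
theorem IsStableWhittaker.eq_quasiWhittakerSpace (hN : IsStableWhittaker φ N)
    (hgen : LieSubmodule.lieSpan ℂ G (N : Set V) = ⊤) : N = quasiWhittakerSpace φ V := by
  refine le_antisymm hN.le fun k hk => ?_
  obtain ⟨n, hn⟩ := exists_mem_productFiltration hgen k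
  induction n with
  | zero =>
    rw [show k = 0 from hn]
    exact zero_mem _
  | succ n ih =>
    obtain ⟨S, hS⟩ := hN.exists_eulerOperator hn
    obtain ⟨L, hL⟩ := exists_pairingSum φ S
    have h := hS L hL
    rw [eulerOperator_eq_zero fun p => whittakerOperator_eq_zero hk p, zero_sub, neg_mem_iff] at h
    -- The Euler operator kills `k`, so `n • k` lies in layer `n`. For `n = 0` this says nothing,
    -- but layer 1 is `N` itself.
    cases n with
    | zero =>
      refine productFiltration_succ_induction (p := fun k => k ∈ N) (fun u hu => hu) ?_
        (fun a b => add_mem) (fun c a => Submodule.smul_mem N c) hn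
      intro x k hk
      rw [show k = 0 from hk, lie_zero]
      exact zero_mem _
    | succ n => exact ih ((Submodule.smul_mem_iff _ (by exact_mod_cast n.succ_ne_zero)).1 h)

/-- A submodule meeting a generating `G^φ`-stable space of quasi-Whittaker vectors trivially
is zero. -/
theorem IsStableWhittaker.eq_bot_of_disjoint (hN : IsStableWhittaker φ N)
    (hgen : LieSubmodule.lieSpan ℂ G (N : Set V) = ⊤) (K : LieSubmodule ℂ G V)
    (hK : ∀ k ∈ K, k ∈ N → k = 0) : K = ⊥ := by
  refine (LieSubmodule.eq_bot_iff K).2 fun k hk => ?_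
  obtain ⟨n, hn⟩ := exists_mem_productFiltration hgen k
  induction n generalizing k with
  | zero => exact hn
  | succ n ih =>
    -- Each `(p - φ(p)) k` lies in `K` one layer lower, so it vanishes by induction; hence `k ∈ V_φ
    -- = N`.
    refine hK k hk ?_
    rw [hN.eq_quasiWhittakerSpace hgen]
    exact fun p => sub_eq_zero.1 (ih (whittakerOperator φ V p k)
      (sub_mem (K.lie_mem hk) (K.smul_mem _ hk)) (hN.whittakerOperator_mem hn p))

end Filtration

/-! ### Eigenvectors and characters -/

section Eigenvectors

/-- An endomorphism whose only nonzero stable subspace is the whole space has an eigenvector. -/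
theorem exists_eigenvector_of_stable_eq_top {M : Type*} [AddCommGroup M] [Module ℂ M]
    [Nontrivial M] (Y : Module.End ℂ M)
    (h : ∀ N : Submodule ℂ M, N ≠ ⊥ → (∀ u ∈ N, Y u ∈ N) → N = ⊤) :
    ∃ v : M, v ≠ 0 ∧ ∃ c : ℂ, Y v = c • v := by
  obtain ⟨v, hv⟩ := exists_ne (0 : M)
  by_cases hYv : Y v = 0
  · exact ⟨v, hv, 0, by rw [hYv, zero_smul]⟩
  -- Strip linear factors from a polynomial annihilating `v`: the last nonzero vector before
  -- reaching zero is an eigenvector.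
  have hroot : ∀ n : ℕ, ∀ q : Polynomial ℂ, q.natDegree = n → q ≠ 0 → Polynomial.aeval Y q v = 0 →
      ∃ v : M, v ≠ 0 ∧ ∃ c : ℂ, Y v = c • v := by
    intro n
    induction n with
    | zero =>
      intro q hdeg hq hqv
      rw [Polynomial.eq_C_of_natDegree_eq_zero hdeg, Polynomial.aeval_C] at hqv
      rcases smul_eq_zero.1 (show q.coeff 0 • v = 0 from hqv) with h0 | h0
      · exact absurd (by rw [Polynomial.eq_C_of_natDegree_eq_zero hdeg, h0, map_zero]) hq
      · exact absurd h0 hv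
    | succ n ih =>
      intro q hdeg hq hqv
      obtain ⟨c, hc⟩ := IsAlgClosed.exists_root q (by
        rw [Polynomial.degree_eq_natDegree hq, hdeg]
        exact_mod_cast n.succ_ne_zero)
      obtain ⟨r, rfl⟩ := Polynomial.dvd_iff_isRoot.2 hc
      have hr : r ≠ 0 := right_ne_zero_of_mul hq
      by_cases hrv : Polynomial.aeval Y r v = 0
      · refine ih r ?_ hr hrv
        rw [Polynomial.natDegree_mul (Polynomial.X_sub_C_ne_zero c) hr,
          Polynomial.natDegree_X_sub_C] at hdeg
        omega
      · refine ⟨_, hrv, c, ?_⟩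
        rw [map_mul, Module.End.mul_apply, map_sub, Polynomial.aeval_X, Polynomial.aeval_C,
          LinearMap.sub_apply, sub_eq_zero] at hqv
        exact hqv
  -- Starting from `Y v` rather than `v` gives `v = f(Y) Y v`, so `f X - 1`, nonzero because its
  -- constant term is `-1`, annihilates `v`.
  let ev : Polynomial ℂ →ₗ[ℂ] M :=
    (LinearMap.applyₗ (Y v)) ∘ₗ (Polynomial.aeval (R := ℂ) Y).toLinearMap
  have hev : ∀ f, ev f = Polynomial.aeval Y f (Y v) := fun f => rfl
  have htop : LinearMap.range ev = ⊤ := by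
    refine h _ (fun hbot => hYv ?_) ?_
    · have : Y v ∈ LinearMap.range ev := ⟨1, by rw [hev, map_one, Module.End.one_apply]⟩
      rwa [hbot, Submodule.mem_bot] at this
    · rintro _ ⟨f, rfl⟩
      exact ⟨Polynomial.X * f, by
        rw [hev, hev, map_mul, Module.End.mul_apply, Polynomial.aeval_X]⟩
  obtain ⟨f, hf⟩ : v ∈ LinearMap.range ev := htop ▸ Submodule.mem_top
  refine hroot _ (f * Polynomial.X - 1) rfl (fun h0 => ?_) ?_
  · simpa using congrArg (Polynomial.eval 0) h0
  · rw [map_sub, map_mul, Polynomial.aeval_X, map_one, LinearMap.sub_apply, Module.End.mul_apply,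
      ← hev, hf, Module.End.one_apply, sub_self]

/-- A common eigenvector of a Lie algebra determines a character. -/
theorem exists_lieCharacter_of_eigenvector {H M : Type*} [LieRing H] [LieAlgebra ℂ H]
    [AddCommGroup M] [Module ℂ M] [LieRingModule H M] [LieModule ℂ H M] {v : M} (hv : v ≠ 0)
    (h : ∀ x : H, ∃ c : ℂ, ⁅x, v⁆ = c • v) :
    ∃ χ : LieCharacter ℂ H, ∀ x : H, ⁅x, v⁆ = χ x • v := by
  choose c hc using h
  have hinj := smul_left_injective ℂ hv
  let _ : LieRing ℂ := LieRing.ofAssociativeRing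
  exact ⟨{
    toFun := c
    map_add' := fun x y => hinj (by simp only [add_smul, ← hc, add_lie])
    map_smul' := fun a x => hinj (by simp only [smul_assoc, ← hc, smul_lie, RingHom.id_apply])
    map_lie' := fun {x y} => hinj (by
      change c ⁅x, y⁆ • v = (c x * c y - c y * c x) • v
      rw [← hc, lie_lie, hc y, lie_smul, hc x, lie_smul, hc y]
      module) }, hc⟩

end Eigenvectors

/-! ### The space `V_φ` of an irreducible module -/

section Irreducible

theorem lieSpan_eq_top_of_ne_bot {G V : Type*} [LieRing G] [AddCommGroup V] [Module ℂ V]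
    [LieRingModule G V] (hirr : LieModule.IsIrreducible ℂ G V) {N : Submodule ℂ V}
    (hN : N ≠ ⊥) : LieSubmodule.lieSpan ℂ G (N : Set V) = ⊤ := by
  obtain ⟨v, hv, hv0⟩ := N.exists_mem_ne_zero_of_ne_bot hN
  refine (IsSimpleOrder.eq_bot_or_eq_top _).resolve_left fun h => hv0 ?_
  exact (LieSubmodule.lieSpan_eq_bot_iff ℂ G V).1 h v hv

variable {G : Type*} [LieRing G] [LieAlgebra ℂ G] {P : LieIdeal ℂ G}
variable {V : Type*} [AddCommGroup V] [Module ℂ V] [LieRingModule G V] [LieModule ℂ G V]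
variable {φ : LieCharacter ℂ P}

theorem lie_mem_quasiWhittakerSpace {x : G} (hx : x ∈ whittakerAnnihilator φ) {v : V}
    (hv : v ∈ quasiWhittakerSpace φ V) : ⁅x, v⁆ ∈ quasiWhittakerSpace φ V := by
  intro p
  have h : ⁅((⁅x, p⁆ : P) : G), v⁆ = 0 := by rw [hv ⁅x, p⁆, hx p, zero_smul]
  rw [LieSubmodule.coe_bracket, lie_lie, hv p, lie_smul, sub_eq_zero] at h
  exact h.symm

/-- If `G^φ / P` is at most one-dimensional, then `V_φ` is spanned by a common eigenvector
of `G^φ`. -/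
theorem exists_span_eq_quasiWhittakerSpace
    (hdim : Module.rank ℂ (whittakerAnnihilator φ ⧸ idealInAnnihilator φ) ≤ 1)
    (hirr : LieModule.IsIrreducible ℂ G V) (hV : IsQuasiWhittakerModule φ V) :
    ∃ v : V, v ≠ 0 ∧ quasiWhittakerSpace φ V = ℂ ∙ v ∧
      ∀ x : whittakerAnnihilator φ, ∃ c : ℂ, ⁅x, v⁆ = c • v := by
  -- Modulo `P`, all of `G^φ` is spanned by `y`. Since `P` acts on `V_φ` by scalars, stability under
  -- `y` alone suffices.
  obtain ⟨y, hy⟩ : ∃ y : whittakerAnnihilator φ, ∀ x : whittakerAnnihilator φ,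
      ∃ c : ℂ, (x : G) - c • (y : G) ∈ P := by
    obtain ⟨y', hy'⟩ := rank_le_one_iff.1 hdim
    obtain ⟨y, rfl⟩ := LieSubmodule.Quotient.surjective_mk' _ y'
    refine ⟨y, fun x => ?_⟩
    obtain ⟨c, hc⟩ := hy' (LieSubmodule.Quotient.mk' _ x)
    refine ⟨c, ?_⟩
    rw [← map_smul] at hc
    have := (LieSubmodule.Quotient.mk_eq_zero' (N := idealInAnnihilator φ) (m := x - c • y)).1
      (by
        change LieSubmodule.Quotient.mk' (idealInAnnihilator φ) (x - c • y) = 0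
        rw [map_sub, hc, sub_self])
    exact this
  have hstable : ∀ N : Submodule ℂ V, N ≤ quasiWhittakerSpace φ V → (∀ u ∈ N, ⁅(y : G), u⁆ ∈ N) →
      IsStableWhittaker φ N := by
    refine fun N hle hN => ⟨hle, fun x hx u hu => ?_⟩
    obtain ⟨c, hc⟩ := hy ⟨x, hx⟩
    have h := hle hu ⟨_, hc⟩
    change ⁅x - c • (y : G), u⁆ = _ at h
    rw [sub_lie, smul_lie, sub_eq_iff_eq_add] at h
    rw [h]
    exact add_mem (N.smul_mem _ hu) (N.smul_mem _ (hN u hu))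
  obtain ⟨v₀, hv₀, hgen⟩ := hV
  have hnt : Nontrivial V := LieModule.nontrivial_of_isIrreducible ℂ G V
  have hv₀0 : v₀ ≠ 0 := by
    rintro rfl
    rw [(LieSubmodule.lieSpan_eq_bot_iff ℂ G V).2 (by simp)] at hgen
    exact bot_ne_top hgen
  have hnt' : Nontrivial (quasiWhittakerSpace φ V) :=
    ⟨⟨v₀, hv₀⟩, 0, fun h => hv₀0 (congrArg Subtype.val h)⟩
  let Y : Module.End ℂ (quasiWhittakerSpace φ V) :=
    (LieModule.toEnd ℂ G V (y : G)).restrict fun v hv => lie_mem_quasiWhittakerSpace y.2 hv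
  have hY : ∀ u, ((Y u : quasiWhittakerSpace φ V) : V) = ⁅(y : G), (u : V)⁆ := fun u => rfl
  obtain ⟨⟨v, hv⟩, hv0, c, hc⟩ := exists_eigenvector_of_stable_eq_top Y (by
    intro N hN hYN
    have h : IsStableWhittaker φ (N.map (quasiWhittakerSpace φ V).subtype) := by
      refine hstable _ (Submodule.map_subtype_le _ _) ?_
      rintro _ ⟨u, hu, rfl⟩
      exact ⟨Y u, hYN u hu, hY u⟩
    have hne : N.map (quasiWhittakerSpace φ V).subtype ≠ ⊥ := by
      rwa [Ne, ← Submodule.map_bot (quasiWhittakerSpace φ V).subtype,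
      (Submodule.map_injective_of_injective (Submodule.injective_subtype _)).eq_iff]
    have heq := h.eq_quasiWhittakerSpace (lieSpan_eq_top_of_ne_bot hirr hne)
    refine Submodule.map_injective_of_injective (Submodule.injective_subtype _) ?_
    rw [heq, Submodule.map_subtype_top])
  have hv0' : v ≠ 0 := fun h => hv0 (Subtype.ext h)
  have hyv : ⁅(y : G), v⁆ = c • v := congrArg Subtype.val hc
  have hN : IsStableWhittaker φ (ℂ ∙ v) := by
    refine hstable _ ((Submodule.span_singleton_le_iff_mem _ _).2 hv) fun u hu => ?_
    obtain ⟨a, rfl⟩ := Submodule.mem_span_singleton.1 hu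
    rw [lie_smul, hyv]
    exact Submodule.smul_mem _ _ (Submodule.smul_mem _ _ (Submodule.mem_span_singleton_self v))
  refine ⟨v, hv0', (hN.eq_quasiWhittakerSpace (lieSpan_eq_top_of_ne_bot hirr
    (by simpa using hv0'))).symm, fun x => ?_⟩
  obtain ⟨a, ha⟩ := Submodule.mem_span_singleton.1
    (hN.lie_mem x x.2 v (Submodule.mem_span_singleton_self v))
  exact ⟨a, ha.symm⟩

end Irreducible

/-! ### Modules induced from characters -/

section InducedCharacters

variable {H : Type*} [LieRing H] [LieAlgebra ℂ H]
variable {G : Type*} [LieRing G] [LieAlgebra ℂ G]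

section

attribute [local instance] LieRing.ofAssociativeRing

/-- By the universal property, the identity of `U(H)` factors through `S`. -/
theorem subalgebra_eq_top_of_ι_mem (S : Subalgebra ℂ (UniversalEnvelopingAlgebra ℂ H))
    (h : ∀ x, UniversalEnvelopingAlgebra.ι ℂ x ∈ S) : S = ⊤ := by
  let j : H →ₗ⁅ℂ⁆ S :=
    { toFun := fun x => ⟨UniversalEnvelopingAlgebra.ι ℂ x, h x⟩
      map_add' := fun x y => Subtype.ext (map_add _ x y)
      map_smul' := fun c x => Subtype.ext (map_smul _ c x)
      map_lie' := fun {x y} => Subtype.ext (LieHom.map_lie _ x y) }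
  have hj : S.val.comp (UniversalEnvelopingAlgebra.lift ℂ j) = AlgHom.id ℂ _ := by
    refine UniversalEnvelopingAlgebra.hom_ext ℂ (LieHom.ext fun x => ?_)
    change ((UniversalEnvelopingAlgebra.lift ℂ j (UniversalEnvelopingAlgebra.ι ℂ x) : S) :
      UniversalEnvelopingAlgebra ℂ H) = UniversalEnvelopingAlgebra.ι ℂ x
    rw [UniversalEnvelopingAlgebra.lift_ι_apply]
    rfl
  refine eq_top_iff.2 fun u _ => ?_
  rw [← show S.val (UniversalEnvelopingAlgebra.lift ℂ j u) = u from DFunLike.congr_fun hj u]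
  exact (UniversalEnvelopingAlgebra.lift ℂ j u).2

theorem enveloping_induction {p : UniversalEnvelopingAlgebra ℂ H → Prop}
    (scalar : ∀ c : ℂ, p (algebraMap ℂ _ c)) (ι : ∀ x, p (UniversalEnvelopingAlgebra.ι ℂ x))
    (add : ∀ a b, p a → p b → p (a + b)) (mul : ∀ a b, p a → p b → p (a * b))
    (u : UniversalEnvelopingAlgebra ℂ H) : p u := by
  let S : Subalgebra ℂ (UniversalEnvelopingAlgebra ℂ H) :=
    { carrier := {a | p a}
      mul_mem' := fun {a b} => mul a b
      add_mem' := fun {a b} => add a b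
      algebraMap_mem' := scalar }
  have h : u ∈ S := subalgebra_eq_top_of_ι_mem S ι ▸ Algebra.mem_top
  exact h

theorem envelopingMap_ι (f : H →ₗ⁅ℂ⁆ G) (x : H) :
    envelopingMap f (UniversalEnvelopingAlgebra.ι ℂ x) = UniversalEnvelopingAlgebra.ι ℂ (f x) :=
  UniversalEnvelopingAlgebra.lift_ι_apply ℂ _ x

theorem envelopingAction_ι (M : Type*) [AddCommGroup M] [Module ℂ M] [LieRingModule H M]
    [LieModule ℂ H M] (x : H) (m : M) :
    envelopingAction M (UniversalEnvelopingAlgebra.ι ℂ x) m = ⁅x, m⁆ := by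
  rw [envelopingAction, UniversalEnvelopingAlgebra.lift_ι_apply]
  rfl

end

variable (f : H →ₗ⁅ℂ⁆ G) (χ : LieCharacter ℂ H)

/-- The identification of `ℂ` with the underlying space of `ℂ_χ`. -/
def charVector : ℂ ≃ₗ[ℂ] CharModule χ := LinearEquiv.refl ℂ ℂ

theorem lie_charModule (x : H) (m : CharModule χ) : ⁅x, m⁆ = χ x • m := rfl

/-- The projection of `U(G) ⊗_ℂ ℂ_χ` onto `Ind ℂ_χ`. -/
def inducedMk : UniversalEnvelopingAlgebra ℂ G ⊗[ℂ] CharModule χ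
    →ₗ[UniversalEnvelopingAlgebra ℂ G] Induced (CharModule χ) f :=
  (balancedRelations (CharModule χ) f).mkQ

theorem inducedMk_surjective : Function.Surjective (inducedMk f χ) :=
  (balancedRelations (CharModule χ) f).mkQ_surjective

theorem inducedMk_eq_of_sub_mem {s t : UniversalEnvelopingAlgebra ℂ G ⊗[ℂ] CharModule χ}
    (h : s - t ∈ balancedRelations (CharModule χ) f) : inducedMk f χ s = inducedMk f χ t :=
  (Submodule.Quotient.eq _).2 h

/-- The canonical generator `1 ⊗ 1` of `Ind ℂ_χ`. -/
def inducedGenerator : Induced (CharModule χ) f :=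
  inducedMk f χ (1 ⊗ₜ[ℂ] charVector χ 1)

theorem ι_smul_eq_lie (x : G) (w : Induced (CharModule χ) f) :
    UniversalEnvelopingAlgebra.ι ℂ x • w = ⁅x, w⁆ := rfl

theorem lie_inducedGenerator (x : H) :
    ⁅f x, inducedGenerator f χ⁆ = χ x • inducedGenerator f χ := by
  rw [← ι_smul_eq_lie, inducedGenerator, ← map_smul, TensorProduct.smul_tmul', smul_eq_mul,
    mul_one, ← LinearMap.map_smul_of_tower (inducedMk f χ), ← TensorProduct.tmul_smul]
  refine inducedMk_eq_of_sub_mem f χ (Submodule.subset_span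
    ⟨1, UniversalEnvelopingAlgebra.ι ℂ x, charVector χ 1, ?_⟩)
  rw [one_mul, envelopingMap_ι, envelopingAction_ι, lie_charModule]

theorem lieSpan_inducedGenerator :
    LieSubmodule.lieSpan ℂ G {inducedGenerator f χ} = ⊤ := by
  set K := LieSubmodule.lieSpan ℂ G {inducedGenerator f χ} with hK
  have hU : ∀ (u : UniversalEnvelopingAlgebra ℂ G), ∀ w ∈ K, u • w ∈ K := by
    intro u
    induction u using enveloping_induction with
    | scalar c =>
      intro w hw
      rw [algebraMap_smul]
      exact K.smul_mem c hw
    | ι x => exact fun w hw => K.lie_mem hw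
    | add a b ha hb =>
      intro w hw
      rw [add_smul]
      exact add_mem (ha w hw) (hb w hw)
    | mul a b ha hb =>
      intro w hw
      rw [mul_smul]
      exact ha _ (hb w hw)
  refine eq_top_iff.2 fun w _ => ?_
  obtain ⟨t, rfl⟩ := inducedMk_surjective f χ w
  induction t using TensorProduct.induction_on with
  | zero => exact zero_mem K
  | add a b ha hb =>
    rw [map_add]
    exact add_mem (ha trivial) (hb trivial)
  | tmul u m =>
    have h : u ⊗ₜ[ℂ] m = (charVector χ).symm m • u • (1 ⊗ₜ[ℂ] charVector χ 1) := by
      rw [TensorProduct.smul_tmul', smul_eq_mul, mul_one, ← TensorProduct.tmul_smul, ← map_smul,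
        smul_eq_mul, mul_one, LinearEquiv.apply_symm_apply]
    rw [h, LinearMap.map_smul_of_tower, map_smul]
    exact K.smul_mem _ (hU u _ (LieSubmodule.subset_lieSpan rfl))

variable {f χ}
variable {V : Type*} [AddCommGroup V] [Module ℂ V] [LieRingModule G V] [LieModule ℂ G V]

/-- This compatibility makes `u ⊗ m ↦ u (m v)` kill the balanced relations. -/
theorem envelopingAction_envelopingMap {v : V} (hv : ∀ x, ⁅f x, v⁆ = χ x • v)
    (a : UniversalEnvelopingAlgebra ℂ H) (m : CharModule χ) :
    envelopingAction V (envelopingMap f a) ((charVector χ).symm m • v) =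
      (charVector χ).symm (envelopingAction (CharModule χ) a m) • v := by
  induction a using enveloping_induction generalizing m with
  | scalar c =>
    rw [AlgHom.commutes, AlgHom.commutes, AlgHom.commutes, Module.algebraMap_end_apply,
      Module.algebraMap_end_apply, map_smul, smul_assoc]
  | ι x =>
    rw [envelopingMap_ι, envelopingAction_ι, envelopingAction_ι, lie_charModule, lie_smul, hv,
      map_smul, smul_assoc, smul_comm]
  | add a b ha hb =>
    rw [map_add, map_add, map_add, LinearMap.add_apply, LinearMap.add_apply, ha, hb, map_add,
      add_smul]
  | mul a b ha hb =>
    rw [map_mul, map_mul, map_mul, Module.End.mul_apply, Module.End.mul_apply, hb, ha]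

/-- The universal property of `Ind ℂ_χ`. -/
theorem exists_inducedHom {v : V} (hv : ∀ x, ⁅f x, v⁆ = χ x • v) :
    ∃ F : Induced (CharModule χ) f →ₗ⁅ℂ, G⁆ V, F (inducedGenerator f χ) = v := by
  let _ : Module (UniversalEnvelopingAlgebra ℂ G) V :=
    Module.compHom V (envelopingAction (H := G) V).toRingHom
  have hsmul : ∀ (u : UniversalEnvelopingAlgebra ℂ G) (w : V), u • w = envelopingAction V u w :=
    fun _ _ => rfl
  have _ : IsScalarTower ℂ (UniversalEnvelopingAlgebra ℂ G) V :=
    ⟨fun c u w => by rw [hsmul, hsmul, map_smul, LinearMap.smul_apply]⟩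
  let T₀ : UniversalEnvelopingAlgebra ℂ G ⊗[ℂ] CharModule χ →ₗ[ℂ] V :=
    TensorProduct.lift (LinearMap.mk₂ ℂ
      (fun (u : UniversalEnvelopingAlgebra ℂ G) (m : CharModule χ) =>
        envelopingAction V u ((charVector χ).symm m • v))
      (fun a b m => by rw [map_add, LinearMap.add_apply])
      (fun c a m => by rw [map_smul (envelopingAction V), LinearMap.smul_apply])
      (fun a m m' => by rw [map_add, add_smul, map_add])
      (fun c a m => by rw [map_smul (charVector χ).symm, smul_assoc, map_smul]))
  have hT₀ : ∀ u m, T₀ (u ⊗ₜ[ℂ] m) = envelopingAction V u ((charVector χ).symm m • v) :=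
    fun u m => TensorProduct.lift.tmul u m
  let T : UniversalEnvelopingAlgebra ℂ G ⊗[ℂ] CharModule χ →ₗ[UniversalEnvelopingAlgebra ℂ G] V :=
    { T₀ with
      map_smul' := fun u t => by
        change T₀ (u • t) = u • T₀ t
        induction t using TensorProduct.induction_on with
        | zero => rw [smul_zero, map_zero, smul_zero]
        | add a b ha hb => rw [smul_add, map_add, map_add, ha, hb, smul_add]
        | tmul a m =>
          rw [TensorProduct.smul_tmul', hT₀, hT₀, smul_eq_mul, map_mul, Module.End.mul_apply]
          rfl }
  have hT : ∀ u m, T (u ⊗ₜ[ℂ] m) = envelopingAction V u ((charVector χ).symm m • v) := hT₀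
  have hle : balancedRelations (CharModule χ) f ≤ LinearMap.ker T := by
    refine Submodule.span_le.2 ?_
    rintro _ ⟨u, a, m, rfl⟩
    rw [SetLike.mem_coe, LinearMap.mem_ker, map_sub, hT, hT, map_mul, Module.End.mul_apply,
      envelopingAction_envelopingMap hv, sub_self]
  let F := (balancedRelations (CharModule χ) f).liftQ T hle
  let F' : Induced (CharModule χ) f →ₗ[UniversalEnvelopingAlgebra ℂ G] V := F
  refine ⟨{ F'.restrictScalars ℂ with
    map_lie' := fun {x w} => ?_ }, ?_⟩
  · change F' (UniversalEnvelopingAlgebra.ι ℂ x • w) = ⁅x, F' w⁆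
    rw [map_smul, hsmul, envelopingAction_ι]
  · change T (1 ⊗ₜ[ℂ] charVector χ 1) = v
    rw [hT, map_one, Module.End.one_apply, LinearEquiv.symm_apply_apply, one_smul]

variable {P : LieIdeal ℂ G} {φ : LieCharacter ℂ P}

/-- Let `χ` be a character of `G^φ`, given along a Lie algebra homomorphism with range `G^φ`,
whose restriction to `P` is `φ`. A module generated by a nonzero vector of type `χ` is
isomorphic to `Ind ℂ_χ`. -/
theorem nonempty_equiv_induced (hf : ∀ x : G, x ∈ whittakerAnnihilator φ ↔ ∃ h, f h = x)
    (hχ : ∀ h (hh : f h ∈ P), χ h = φ ⟨f h, hh⟩) {v : V} (hv : ∀ x, ⁅f x, v⁆ = χ x • v)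
    (hv0 : v ≠ 0) (hgen : LieSubmodule.lieSpan ℂ G {v} = ⊤) :
    Nonempty (V ≃ₗ⁅ℂ, G⁆ Induced (CharModule χ) f) := by
  obtain ⟨F, hF⟩ := exists_inducedHom hv
  set w := inducedGenerator f χ
  have hw : ∀ x, ⁅f x, w⁆ = χ x • w := lie_inducedGenerator f χ
  have hstable : IsStableWhittaker φ (ℂ ∙ w) := by
    refine ⟨(Submodule.span_singleton_le_iff_mem _ _).2 fun p => ?_, fun x hx u hu => ?_⟩
    · obtain ⟨h, hh⟩ := (hf p).1 (mem_whittakerAnnihilator φ p)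
      rw [← hh, hw, hχ h (hh ▸ p.2)]
      congr 2
      exact Subtype.ext hh
    · obtain ⟨h, rfl⟩ := (hf x).1 hx
      obtain ⟨c, rfl⟩ := Submodule.mem_span_singleton.1 hu
      rw [lie_smul, hw]
      exact Submodule.smul_mem _ _ (Submodule.smul_mem _ _ (Submodule.mem_span_singleton_self w))
  have hspan : LieSubmodule.lieSpan ℂ G
      ((ℂ ∙ w : Submodule ℂ (Induced (CharModule χ) f)) : Set (Induced (CharModule χ) f)) = ⊤ := by
    refine eq_top_iff.2 ((lieSpan_inducedGenerator f χ).ge.trans (LieSubmodule.lieSpan_mono ?_))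
    exact Set.singleton_subset_iff.2 (Submodule.mem_span_singleton_self w)
  -- `F` sends `c w` to `c v` with `v ≠ 0`, so its kernel misses the line through `w` and must
  -- vanish.
  have hker : F.ker = ⊥ := by
    refine hstable.eq_bot_of_disjoint hspan _ fun k hk hkw => ?_
    obtain ⟨c, rfl⟩ := Submodule.mem_span_singleton.1 hkw
    rw [LieModuleHom.mem_ker, map_smul, hF] at hk
    rw [(smul_eq_zero.1 hk).resolve_right hv0, zero_smul]
  have hrange : F.range = ⊤ := by
    refine eq_top_iff.2 (hgen.ge.trans (LieSubmodule.lieSpan_le.2 ?_))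
    exact Set.singleton_subset_iff.2 ⟨w, hF⟩
  let e := LinearEquiv.ofBijective (F : Induced (CharModule χ) f →ₗ[ℂ] V)
    ⟨(LieModuleHom.ker_eq_bot F).1 hker, (LieModuleHom.range_eq_top F).1 hrange⟩
  exact ⟨LieModuleEquiv.symm
    { F with invFun := e.symm, left_inv := e.left_inv, right_inv := e.right_inv }⟩

end InducedCharacters

end QuasiWhittaker

end

/-! ### The main theorem -/

theorem theorem3p10 {G : Type*} [LieRing G] [LieAlgebra ℂ G]
    (_hG : ¬ LieAlgebra.IsSemisimple ℂ G)
    (P : LieIdeal ℂ G) (_hP : ⁅P, P⁆ ≠ P) (φ : LieAlgebra.LieCharacter ℂ P)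
    (hdim : Module.rank ℂ
      (QuasiWhittaker.whittakerAnnihilator φ ⧸ QuasiWhittaker.idealInAnnihilator φ) ≤ 1)
    (V : Type*) [AddCommGroup V] [Module ℂ V] [LieRingModule G V] [LieModule ℂ G V]
    (hirr : LieModule.IsIrreducible ℂ G V)
    (hV : QuasiWhittaker.IsQuasiWhittakerModule φ V) :
    QuasiWhittaker.IsBland φ V ∧
    (Module.rank ℂ
        (QuasiWhittaker.whittakerAnnihilator φ ⧸ QuasiWhittaker.idealInAnnihilator φ) = 0 →
      Nonempty (V ≃ₗ⁅ℂ, G⁆ QuasiWhittaker.universalModule φ)) ∧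
    (Module.rank ℂ
        (QuasiWhittaker.whittakerAnnihilator φ ⧸ QuasiWhittaker.idealInAnnihilator φ) = 1 →
      ∃ φ' : LieAlgebra.LieCharacter ℂ (QuasiWhittaker.whittakerAnnihilator φ),
        QuasiWhittaker.IsExtension φ φ' ∧
        Nonempty (V ≃ₗ⁅ℂ, G⁆ QuasiWhittaker.extensionModule φ φ')) := by
  obtain ⟨v, hv0, hspan, hev⟩ :=
    QuasiWhittaker.exists_span_eq_quasiWhittakerSpace hdim hirr hV
  have hmem : v ∈ QuasiWhittaker.quasiWhittakerSpace φ V :=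
    hspan ▸ Submodule.mem_span_singleton_self v
  have hgen : LieSubmodule.lieSpan ℂ G {v} = ⊤ := by
    have hne : Submodule.span ℂ {v} ≠ ⊥ := by simpa using hv0
    refine eq_top_iff.2 ((QuasiWhittaker.lieSpan_eq_top_of_ne_bot hirr hne).ge.trans
      (LieSubmodule.lieSpan_le.2 fun u hu => ?_))
    obtain ⟨c, rfl⟩ := Submodule.mem_span_singleton.1 hu
    exact SMulMemClass.smul_mem c (LieSubmodule.subset_lieSpan rfl)
  refine ⟨?_, fun hrank => ?_, fun _ => ?_⟩
  · rw [QuasiWhittaker.IsBland, hspan]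
    exact rank_submodule_eq_one_iff _ |>.2
      ⟨v, Submodule.mem_span_singleton_self v, hv0, le_rfl⟩
  -- Here `G^φ = P`, so the inclusion of `P` already has range `G^φ`.
  · refine QuasiWhittaker.nonempty_equiv_induced (φ := φ) (fun x => ⟨fun hx => ?_, ?_⟩)
      (fun _ _ => rfl) hmem hv0 hgen
    · have : Subsingleton (QuasiWhittaker.whittakerAnnihilator φ ⧸
        QuasiWhittaker.idealInAnnihilator φ) := rank_zero_iff.1 hrank
      have h : (⟨x, hx⟩ : QuasiWhittaker.whittakerAnnihilator φ) ∈
          QuasiWhittaker.idealInAnnihilator φ :=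
        LieSubmodule.Quotient.mk_eq_zero'.1 (Subsingleton.elim _ _)
      exact ⟨⟨x, h⟩, rfl⟩
    · rintro ⟨p, rfl⟩
      exact QuasiWhittaker.mem_whittakerAnnihilator φ p
  -- The character `φ'` records the eigenvalues of `G^φ` on `v`; it extends `φ` because `v ∈ V_φ` is
  -- nonzero.
  · obtain ⟨φ', hφ'⟩ := QuasiWhittaker.exists_lieCharacter_of_eigenvector hv0 hev
    have hext : QuasiWhittaker.IsExtension φ φ' := fun p =>
      smul_left_injective ℂ hv0
        ((hφ' ⟨p, QuasiWhittaker.mem_whittakerAnnihilator φ p⟩).symm.trans (hmem p))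
    refine ⟨φ', hext, QuasiWhittaker.nonempty_equiv_induced (φ := φ) (fun x => ⟨fun hx => ?_, ?_⟩)
      (fun h hh => hext ⟨(h : G), hh⟩) hφ' hv0 hgen⟩
    · exact ⟨⟨x, hx⟩, rfl⟩
    · rintro ⟨h, rfl⟩
      exact h.2
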